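/- The king grid is the graph with vertex set $\mathbb{Z}^2$ in which two vertices $\mathbf{u},\mathbf{v}$ are adjacent if and only if $\mathbf{u}-\mathbf{v}\in\{(\pm1,0),(0,\pm1),(\pm1,\pm1)\}$ (all choices of signs). For a vertex $\mathbf{u}$ and an integer $r\ge 0$, its (closed) $r$-neighborhood $N_r(\mathbf{u})$ is the set of all vertices at graph distance at most $r$ from $\mathbf{u}$. Let $a,b$ be non-negative integers. For a finite set $D\subseteq\mathbb{Z}^2$, a configuration $c\in\{0,1\}^{\mathbb{Z}^2}$ is a $(D,b,a)$-covering if for every $\mathbf{u}\in\mathbb{Z}^2$ the number of $\mathbf{v}\in\mathbf{u}+D$ with $c(\mathbf{v})=1$ is $b$ if $c(\mathbf{u})=1$ and is $a$ if $c(\mathbf{u})=0$. A set $S\subseteq\mathbb{Z}^2$ is an $(r,b,a)$-covering in the king grid if for every $\mathbf{u}\in\mathbb{Z}^2$ one has $|N_r(\mathbf{u})\cap S|=b$ if $\mathbf{u}\in S$ and $|N_r(\mathbf{u})\cap S|=a$ if $\mathbf{u}\notin S$. A configuration $c$ is two-periodic if there are linearly independent vectors $\mathbf{t}_1,\mathbf{t}_2\in\mathbb{Z}^2$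 such that $c(\mathbf{u}-\mathbf{t}_i)=c(\mathbf{u})$ for all $\mathbf{u}\in\mathbb{Z}^2$ and $i=1,2$. A set $S\subseteq\mathbb{Z}^2$ is two-periodic if there are linearly independent vectors $\mathbf{t}_1,\mathbf{t}_2\in\mathbb{Z}^2$ such that $S=S+\mathbf{t}_1$ and $S=S+\mathbf{t}_2$. **Theorem.** Let $r\ge 1$ be an integer, let $D=N_r(\mathbf{0})$ be the $r$-neighborhood of $\mathbf{0}$ in the king grid, and let $a\neq b$ be non-negative integers. Then every $(D,b,a)$-covering is two-periodic. In other words, every $(r,b,a)$-covering in the king grid is two-periodic. -/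

import Mathlib

namespace PerfectCovering

/-- The closed `r`-neighborhood `N_r(u)` of a vertex `u` of a graph: all vertices whose graph distance
to `u` is at most `r` (the distance between vertices in different components is `⊤`). -/
def closedNeighborhood {V : Type*} (G : SimpleGraph V) (r : ℕ) (u : V) : Set V :=
  {v | G.edist v u ≤ (r : ℕ∞)}

/-- A code `S` is an `(r, b, a)`-covering in the graph `G` if the closed `r`-neighborhood of each
vertex in `S` contains exactly `b` elements of `S` and that of each vertex outside `S` contains
exactly `a` elements of `S`. -/
def IsGraphCovering {V : Type*} (G : SimpleGraph V) (r b a : ℕ) (S : Set V) : Prop :=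
  ∀ u : V,
    (u ∈ S → (closedNeighborhood G r u ∩ S).encard = (b : ℕ∞)) ∧
    (u ∉ S → (closedNeighborhood G r u ∩ S).encard = (a : ℕ∞))

/-- The king grid: the graph with vertex set `ℤ²` in which two vertices are adjacent if their
difference is one of the eight vectors `(±1, 0)`, `(0, ±1)`, `(±1, ±1)`. -/
def kingGrid : SimpleGraph (ℤ × ℤ) where
  Adj u v := u - v ∈
    ({(1, 0), (-1, 0), (0, 1), (0, -1), (1, 1), (1, -1), (-1, 1), (-1, -1)} : Set (ℤ × ℤ))
  symm := ⟨by
    rintro ⟨u₁, u₂⟩ ⟨v₁, v₂⟩ h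
    simp only [Prod.mk_sub_mk, Set.mem_insert_iff, Set.mem_singleton_iff, Prod.mk.injEq] at h ⊢
    omega⟩
  loopless := ⟨by
    rintro ⟨u₁, u₂⟩ h
    simp [Prod.ext_iff] at h⟩

/-- A two-dimensional binary configuration. -/
abbrev BinaryConfiguration : Type := ℤ × ℤ → Fin 2

/-- The configuration `c` is a `(D, b, a)`-covering: for every cell `u`, the pattern of `c` on the
translate `u + D` contains exactly `b` symbols `1` if `c u = 1`, and exactly `a` if `c u = 0`. -/
def IsShapeCovering (D : Set (ℤ × ℤ)) (b a : ℕ) (c : BinaryConfiguration) : Prop :=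
  ∀ u : ℤ × ℤ,
    (c u = 1 → {v | v ∈ (fun w => u + w) '' D ∧ c v = 1}.encard = (b : ℕ∞)) ∧
    (c u = 0 → {v | v ∈ (fun w => u + w) '' D ∧ c v = 1}.encard = (a : ℕ∞))

/-- The translation of a configuration by the vector `t`. -/
def translate (t : ℤ × ℤ) (c : BinaryConfiguration) : BinaryConfiguration :=
  fun u => c (u - t)

/-- A configuration is two-periodic if it has two linearly independent vectors of periodicity. -/
def IsTwoPeriodicConfiguration (c : BinaryConfiguration) : Prop :=
  ∃ t₁ t₂ : ℤ × ℤ, LinearIndependent ℤ ![t₁, t₂] ∧ translate t₁ c = c ∧ translate t₂ c = c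

/-- A code `S ⊆ ℤ²` is two-periodic if `S = S + t₁` and `S = S + t₂` for some linearly independent
vectors `t₁`, `t₂`. -/
def IsTwoPeriodicCode (S : Set (ℤ × ℤ)) : Prop :=
  ∃ t₁ t₂ : ℤ × ℤ, LinearIndependent ℤ ![t₁, t₂] ∧
    S = (fun s => s + t₁) '' S ∧ S = (fun s => s + t₂) '' S

end PerfectCovering

/-!
Encode a covering by its indicator function `c : ℤ × ℤ → ℤ`. In the king grid the `r`-neighborhood
of `u` is the square of side `m = 2 r + 1` centered at `u`, so the sum of `c` over this square is
`a + k c(u)` with `k = b - a ≠ 0`. The difference `e` of two translates of `c` takes values in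
`{-1, 0, 1}`, and its sum over the square centered at `u` is `k e(u)` (`IsBoxEigen`).

Such an `e` vanishes everywhere as soon as it vanishes on a sufficiently large rectangle
(`IsBoxEigen.eq_zero_of_rect`). Indeed, let `g` be the row just above the rectangle and `h` the row
`r` steps above `g`. Comparing the sums over vertically adjacent squares shows that, along the
rectangle, the sums of `g` over windows of length `m` vanish, while the sum of `h` over the window
centered at `x` is `k g(x)`. Hence `g` is `m`-periodic, and `h(x + m) - h(x)` is the `m`-periodic
function `k (g(x + r + 1) - g(x + r))`. As `h` is bounded, this function must vanish; so `g` is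
constant, and being of zero sum it is zero (`eq_zero_of_window_sums`). The rectangle thus
grows by one row, and by symmetry it grows in all four directions.

There are finitely many patterns on a fixed large square, so among the translates of `c` by the
multiples of a vector `t` two agree on that square, and therefore everywhere. This gives a period
that is a positive multiple of `t` (`exists_period`), and it is applied to `(1, 0)` and `(0, 1)`.
-/

namespace PerfectCovering

open Finset

/-! ### Window sums in one dimension -/

/-- The sum of `g` over the window of radius `r` centered at `x`. -/
noncomputable def windowSum (r : ℕ) (g : ℤ → ℤ) (x : ℤ) : ℤ := ∑ i ∈ Icc (-(r : ℤ)) r, g (x + i)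

lemma windowSum_eq_Icc (r : ℕ) (g : ℤ → ℤ) (x : ℤ) :
    windowSum r g x = ∑ i ∈ Icc (x - r) (x + r), g i := by
  unfold windowSum
  refine sum_equiv (Equiv.addLeft x) (fun i => ?_) fun _ _ => rfl
  simp only [mem_Icc, Equiv.coe_addLeft]
  omega

lemma windowSum_succ (r : ℕ) (g : ℤ → ℤ) (x : ℤ) :
    windowSum r g (x + 1) = windowSum r g x + g (x + r + 1) - g (x - r) := by
  rw [windowSum_eq_Icc, windowSum_eq_Icc]
  have h₁ : Icc (x - r) (x + r + 1) = insert (x + r + 1) (Icc (x - r) (x + r)) := by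
    ext i; simp only [mem_Icc, mem_insert]; omega
  have h₂ : Icc (x - r) (x + r + 1) = insert (x - r) (Icc (x + 1 - r) (x + 1 + r)) := by
    ext i; simp only [mem_Icc, mem_insert]; omega
  have h := congrArg (fun s => ∑ i ∈ s, g i) (h₁.symm.trans h₂)
  beta_reduce at h
  rw [sum_insert (by simp), sum_insert (by simp)] at h
  linarith

lemma windowSum_eq_zero {r : ℕ} {g : ℤ → ℤ} {x : ℤ}
    (h : ∀ i, x - r ≤ i → i ≤ x + r → g i = 0) : windowSum r g x = 0 := by
  rw [windowSum_eq_Icc]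
  refine sum_eq_zero fun i hi => ?_
  rw [mem_Icc] at hi
  exact h i hi.1 hi.2

/-- If, on a long interval, the window sums of `g` vanish and those of a bounded function `h` are
`k g` with `k ≠ 0`, then `g` vanishes there: otherwise `h` would grow linearly. -/
lemma eq_zero_of_window_sums {r : ℕ} {k : ℤ} (hk : k ≠ 0) {g h : ℤ → ℤ}
    (hh : ∀ x, |h x| ≤ 1) {x₀ x₁ : ℤ} (hx : x₀ + 5 * (2 * r + 1) ≤ x₁)
    (hg0 : ∀ x, x₀ + r ≤ x → x ≤ x₁ - r → windowSum r g x = 0)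
    (hhg : ∀ x, x₀ + r ≤ x → x ≤ x₁ - r → windowSum r h x = k * g x)
    {x : ℤ} (hx₀ : x₀ ≤ x) (hx₁ : x ≤ x₁) : g x = 0 := by
  have g_per : ∀ y, x₀ ≤ y → y + (2 * r + 1) ≤ x₁ → g (y + (2 * r + 1)) = g y := by
    intro y h₀ h₁
    have h := windowSum_succ r g (y + r)
    rw [hg0 _ (by omega) (by omega), hg0 _ (by omega) (by omega)] at h
    rw [show y + (2 * r + 1) = y + r + r + 1 by ring]
    rw [add_sub_cancel_right] at h
    linarith
  have h_step : ∀ y, x₀ ≤ y → y + (2 * r + 1) ≤ x₁ →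
      h (y + (2 * r + 1)) = h y + k * (g (y + r + 1) - g (y + r)) := by
    intro y h₀ h₁
    have h := windowSum_succ r h (y + r)
    rw [hhg _ (by omega) (by omega), hhg _ (by omega) (by omega)] at h
    rw [show y + (2 * r + 1) = y + r + r + 1 by ring]
    rw [add_sub_cancel_right] at h
    linarith
  -- Three steps change `h` by three times the same multiple of `k`, but by at most `2`.
  have g_const : ∀ y, x₀ ≤ y → y ≤ x₀ + 2 * r → g (y + r + 1) = g (y + r) := by
    intro y h₀ h₁
    have s₀ := h_step y (by omega) (by omega)
    have s₁ := h_step (y + (2 * r + 1)) (by omega) (by omega)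
    have s₂ := h_step (y + (2 * r + 1) + (2 * r + 1)) (by omega) (by omega)
    have p₀ := g_per (y + r) (by omega) (by omega)
    have p₁ := g_per (y + r + 1) (by omega) (by omega)
    have p₂ := g_per (y + r + (2 * r + 1)) (by omega) (by omega)
    have p₃ := g_per (y + r + 1 + (2 * r + 1)) (by omega) (by omega)
    have e₀ : y + (2 * r + 1) + r = y + r + (2 * r + 1) := by ring
    have e₁ : y + r + (2 * r + 1) + 1 = y + r + 1 + (2 * r + 1) := by ring
    have e₂ : y + (2 * r + 1) + (2 * r + 1) + r = y + r + (2 * r + 1) + (2 * r + 1) := by ring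
    have e₃ : y + r + (2 * r + 1) + (2 * r + 1) + 1 = y + r + 1 + (2 * r + 1) + (2 * r + 1) := by
      ring
    rw [e₀, e₁, p₀, p₁] at s₁
    rw [e₂, e₃, p₂, p₃, p₀, p₁] at s₂
    have b₀ := abs_le.mp (hh y)
    have b₁ := abs_le.mp (hh (y + (2 * r + 1) + (2 * r + 1) + (2 * r + 1)))
    have hd : k * (g (y + r + 1) - g (y + r)) = 0 := by omega
    rcases mul_eq_zero.mp hd with h | h
    · exact absurd h hk
    · linarith
  have g_eq : ∀ n : ℕ, n ≤ 2 * r → g (x₀ + r + n) = g (x₀ + r) := by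
    intro n
    induction n with
    | zero => simp
    | succ n ih =>
      intro hn
      rw [← ih (by omega), show x₀ + r + ((n + 1 : ℕ) : ℤ) = x₀ + n + r + 1 by push_cast; ring,
        g_const (x₀ + n) (by omega) (by omega), add_right_comm]
  have g_zero : g (x₀ + r) = 0 := by
    have h := hg0 (x₀ + 2 * r) (by omega) (by omega)
    rw [windowSum_eq_Icc, sum_congr rfl (g := fun _ => g (x₀ + r)), sum_const,
      nsmul_eq_mul, mul_eq_zero] at h
    · refine h.resolve_left ?_
      rw [Int.card_Icc]
      omega
    · intro i hi
      rw [mem_Icc] at hi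
      have := g_eq (i - (x₀ + r)).toNat (by omega)
      rwa [Int.toNat_of_nonneg (by omega), add_sub_cancel] at this
  have g_right : ∀ n : ℕ, x₀ + r + n ≤ x₁ → g (x₀ + r + n) = 0 := by
    intro n
    induction n using Nat.strong_induction_on with
    | _ n ih =>
      intro hn
      by_cases h : n ≤ 2 * r
      · rw [g_eq n h, g_zero]
      · have h₁ := ih (n - (2 * r + 1)) (by omega) (by omega)
        have h₂ := g_per (x₀ + r + ((n - (2 * r + 1) : ℕ) : ℤ)) (by omega) (by omega)
        rw [h₁] at h₂
        rw [← h₂]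
        congr 1
        omega
  by_cases h : x₀ + r ≤ x
  · have := g_right (x - (x₀ + r)).toNat (by omega)
    rwa [Int.toNat_of_nonneg (by omega), add_sub_cancel] at this
  · rw [← g_per x (by omega) (by omega)]
    have := g_right (x + (2 * r + 1) - (x₀ + r)).toNat (by omega)
    rwa [Int.toNat_of_nonneg (by omega), add_sub_cancel] at this

/-! ### Eigenfunctions of the box sum -/

/-- A function on `ℤ²` with values in `{-1, 0, 1}` whose sum over the square of radius `r` centered
at any cell is `k` times its value at that cell. -/
structure IsBoxEigen (r : ℕ) (k : ℤ) (e : ℤ → ℤ → ℤ) : Prop where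
  abs_le_one : ∀ x y, |e x y| ≤ 1
  sum_eq : ∀ x y, ∑ j ∈ Icc (-(r : ℤ)) r, ∑ i ∈ Icc (-(r : ℤ)) r, e (x + i) (y + j) = k * e x y

namespace IsBoxEigen

variable {r : ℕ} {k : ℤ} {e : ℤ → ℤ → ℤ}

lemma transpose (he : IsBoxEigen r k e) : IsBoxEigen r k fun x y => e y x where
  abs_le_one x y := he.abs_le_one y x
  sum_eq x y := by rw [sum_comm]; exact he.sum_eq y x

lemma reflect (he : IsBoxEigen r k e) : IsBoxEigen r k fun x y => e x (-y) where
  abs_le_one x y := he.abs_le_one x (-y)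
  sum_eq x y := by
    rw [← he.sum_eq x (-y)]
    refine sum_equiv (Equiv.neg ℤ) (fun j => ?_) fun j _ => ?_
    · simp only [mem_Icc, Equiv.neg_apply]; omega
    · simp only [Equiv.neg_apply, neg_add]

lemma sum_windowSum (he : IsBoxEigen r k e) (x y : ℤ) :
    windowSum r (fun j => windowSum r (fun i => e i j) x) y = k * e x y :=
  he.sum_eq x y

lemma windowSum_row (he : IsBoxEigen r k e) (x y : ℤ) :
    windowSum r (fun i => e i (y + r + 1)) x =
      windowSum r (fun i => e i (y - r)) x + k * (e x (y + 1) - e x y) := by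
  have h := windowSum_succ r (fun j => windowSum r (fun i => e i j) x) y
  rw [he.sum_windowSum, he.sum_windowSum] at h
  linarith

lemma eq_zero_row_above (hr : 1 ≤ r) (hk : k ≠ 0) (he : IsBoxEigen r k e) {x₀ x₁ y₀ y₁ : ℤ}
    (hx : x₀ + 5 * (2 * r + 1) ≤ x₁) (hy : y₀ + 5 * (2 * r + 1) ≤ y₁)
    (h0 : ∀ x y, x₀ ≤ x → x ≤ x₁ → y₀ ≤ y → y ≤ y₁ → e x y = 0) {x : ℤ}
    (hx₀ : x₀ ≤ x) (hx₁ : x ≤ x₁) : e x (y₁ + 1) = 0 := by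
  refine eq_zero_of_window_sums (r := r) hk (g := fun x => e x (y₁ + 1))
    (h := fun x => e x (y₁ + r + 1)) (fun x => he.abs_le_one _ _) hx ?_ ?_ hx₀ hx₁
  · intro z h₀ h₁
    have h := he.windowSum_row z (y₁ - r)
    rw [sub_add_cancel] at h
    rw [h, windowSum_eq_zero, h0 _ _ (by omega) (by omega) (by omega) (by omega),
      h0 _ _ (by omega) (by omega) (by omega) (by omega)]
    · simp
    · intro i _ _
      exact h0 _ _ (by omega) (by omega) (by omega) (by omega)
  · intro z h₀ h₁
    rw [he.windowSum_row z y₁, windowSum_eq_zero,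
      h0 z y₁ (by omega) (by omega) (by omega) (by omega)]
    · simp
    · intro i _ _
      exact h0 _ _ (by omega) (by omega) (by omega) (by omega)

lemma eq_zero_rows (hr : 1 ≤ r) (hk : k ≠ 0) (he : IsBoxEigen r k e) {x₀ x₁ y₀ y₁ : ℤ}
    (hx : x₀ + 5 * (2 * r + 1) ≤ x₁) (hy : y₀ + 5 * (2 * r + 1) ≤ y₁)
    (h0 : ∀ x y, x₀ ≤ x → x ≤ x₁ → y₀ ≤ y → y ≤ y₁ → e x y = 0)
    (x y : ℤ) (hx₀ : x₀ ≤ x) (hx₁ : x ≤ x₁) (hy₀ : y₀ - 1 ≤ y) (hy₁ : y ≤ y₁ + 1) :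
    e x y = 0 := by
  by_cases h₁ : y = y₁ + 1
  · rw [h₁]
    exact he.eq_zero_row_above hr hk hx hy h0 hx₀ hx₁
  by_cases h₂ : y = y₀ - 1
  · have := he.reflect.eq_zero_row_above hr hk hx (y₀ := -y₁) (y₁ := -y₀) (by omega)
      (fun x y _ _ _ _ => h0 x (-y) (by omega) (by omega) (by omega) (by omega)) hx₀ hx₁
    rwa [neg_add, neg_neg, ← sub_eq_add_neg, ← h₂] at this
  exact h0 x y hx₀ hx₁ (by omega) (by omega)

lemma eq_zero_of_rect (hr : 1 ≤ r) (hk : k ≠ 0) (he : IsBoxEigen r k e) {x₀ x₁ y₀ y₁ : ℤ}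
    (hx : x₀ + 5 * (2 * r + 1) ≤ x₁) (hy : y₀ + 5 * (2 * r + 1) ≤ y₁)
    (h0 : ∀ x y, x₀ ≤ x → x ≤ x₁ → y₀ ≤ y → y ≤ y₁ → e x y = 0) (x y : ℤ) : e x y = 0 := by
  have grow : ∀ n : ℕ, ∀ x y, x₀ - n ≤ x → x ≤ x₁ + n → y₀ - n ≤ y → y ≤ y₁ + n →
      e x y = 0 := by
    intro n
    induction n with
    | zero => simpa using h0
    | succ n ih =>
      intro x y h₁ h₂ h₃ h₄
      have h := he.eq_zero_rows hr hk (by omega) (by omega) ih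
      exact he.transpose.eq_zero_rows hr hk (by omega) (by omega)
        (fun y x i₁ i₂ i₃ i₄ => h x y i₃ i₄ i₁ i₂) y x (by omega) (by omega) (by omega) (by omega)
  exact grow ((x₀ - x).toNat + (x - x₁).toNat + (y₀ - y).toNat + (y - y₁).toNat) x y
    (by omega) (by omega) (by omega) (by omega)

end IsBoxEigen

/-! ### Neighborhoods in the king grid -/

lemma kingGrid_adj_iff {u v : ℤ × ℤ} :
    kingGrid.Adj u v ↔ u ≠ v ∧ |u.1 - v.1| ≤ 1 ∧ |u.2 - v.2| ≤ 1 := by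
  obtain ⟨x, y⟩ := u
  obtain ⟨z, w⟩ := v
  simp only [kingGrid, Prod.mk_sub_mk, Set.mem_insert_iff, Set.mem_singleton_iff, Prod.mk.injEq,
    ne_eq, abs_le]
  omega

lemma abs_sub_le_length_of_walk {u v : ℤ × ℤ} (p : kingGrid.Walk u v) :
    |u.1 - v.1| ≤ p.length ∧ |u.2 - v.2| ≤ p.length := by
  induction p with
  | nil => simp
  | cons h p ih =>
    obtain ⟨-, h₁, h₂⟩ := kingGrid_adj_iff.mp h
    rw [SimpleGraph.Walk.length_cons]
    push_cast
    simp only [abs_le] at *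
    omega

lemma edist_kingGrid_le {n : ℕ} {u v : ℤ × ℤ} (h₁ : |u.1 - v.1| ≤ n) (h₂ : |u.2 - v.2| ≤ n) :
    kingGrid.edist u v ≤ n := by
  induction n generalizing u with
  | zero =>
    have : u = v := by
      simp only [abs_le] at h₁ h₂
      ext <;> omega
    simp [this]
  | succ n ih =>
    -- Step one unit towards `v` in each coordinate in which `u` and `v` differ.
    let w : ℤ × ℤ := (u.1 - (u.1 - v.1).sign, u.2 - (u.2 - v.2).sign)
    have hs : ∀ z : ℤ, |z| ≤ (n + 1 : ℕ) → |z - z.sign| ≤ n ∧ |z.sign| ≤ 1 := by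
      intro z hz
      simp only [abs_le] at *
      rcases lt_trichotomy z 0 with h | h | h
      · rw [Int.sign_eq_neg_one_of_neg h]; omega
      · subst h; simp
      · rw [Int.sign_eq_one_of_pos h]; omega
    have hw : kingGrid.edist w v ≤ n := by
      apply ih
      · rw [show w.1 - v.1 = u.1 - v.1 - (u.1 - v.1).sign by simp only [w]; ring]
        exact (hs _ h₁).1
      · rw [show w.2 - v.2 = u.2 - v.2 - (u.2 - v.2).sign by simp only [w]; ring]
        exact (hs _ h₂).1
    have huw : kingGrid.edist u w ≤ 1 := by
      by_cases h : u = w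
      · rw [← h]; simp
      · refine (SimpleGraph.edist_eq_one_iff_adj.mpr (kingGrid_adj_iff.mpr ⟨h, ?_, ?_⟩)).le
        · simpa [w] using (hs _ h₁).2
        · simpa [w] using (hs _ h₂).2
    calc kingGrid.edist u v ≤ kingGrid.edist u w + kingGrid.edist w v :=
          SimpleGraph.edist_triangle
      _ ≤ 1 + n := add_le_add huw hw
      _ = ((n + 1 : ℕ) : ℕ∞) := by push_cast; rw [add_comm]

lemma mem_closedNeighborhood_kingGrid {r : ℕ} {u v : ℤ × ℤ} :
    v ∈ closedNeighborhood kingGrid r u ↔ |v.1 - u.1| ≤ r ∧ |v.2 - u.2| ≤ r := by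
  refine ⟨fun h => ?_, fun h => edist_kingGrid_le h.1 h.2⟩
  have h : kingGrid.edist v u ≤ r := h
  obtain ⟨p, hp⟩ := SimpleGraph.exists_walk_of_edist_ne_top
    (ne_top_of_le_ne_top (ENat.natCast_ne_top r) h)
  rw [← hp, Nat.cast_le] at h
  have := abs_sub_le_length_of_walk p
  omega

lemma image_add_closedNeighborhood_kingGrid (r : ℕ) (u : ℤ × ℤ) :
    (fun w => u + w) '' closedNeighborhood kingGrid r 0 = closedNeighborhood kingGrid r u := by
  ext v
  simp only [Set.image_add_left, Set.mem_preimage, mem_closedNeighborhood_kingGrid]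
  simp [neg_add_eq_sub]

/-! ### Periods of coverings -/

open Classical in
/-- The indicator function of a set of cells, as an integer-valued function of two coordinates. -/
noncomputable def cellIndicator (S : Set (ℤ × ℤ)) (x y : ℤ) : ℤ := if (x, y) ∈ S then 1 else 0

lemma encard_closedNeighborhood_inter (r : ℕ) (S : Set (ℤ × ℤ)) (x y : ℤ) {n : ℕ}
    (h : (closedNeighborhood kingGrid r (x, y) ∩ S).encard = n) :
    ∑ j ∈ Icc (-(r : ℤ)) r, ∑ i ∈ Icc (-(r : ℤ)) r, cellIndicator S (x + i) (y + j) = n := by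
  classical
  let T : Finset (ℤ × ℤ) := ((Icc (-(r : ℤ)) r ×ˢ Icc (-(r : ℤ)) r).filter
    fun p => (x + p.2, y + p.1) ∈ S)
  have hinj : Function.Injective fun p : ℤ × ℤ => (x + p.2, y + p.1) := by
    rintro ⟨p, q⟩ ⟨p', q'⟩ h
    simp only [Prod.mk.injEq, add_right_inj] at h ⊢
    exact h.symm
  have hT : closedNeighborhood kingGrid r (x, y) ∩ S =
      (fun p : ℤ × ℤ => (x + p.2, y + p.1)) '' T := by
    ext ⟨z, w⟩
    simp only [Set.mem_inter_iff, mem_closedNeighborhood_kingGrid, Set.mem_image, abs_le, T,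
      coe_filter, mem_product, mem_Icc, Set.mem_ofPred_eq, Prod.exists, Prod.mk.injEq]
    constructor
    · rintro ⟨h, hS⟩
      refine ⟨w - y, z - x, ⟨by omega, ?_⟩, by omega, by omega⟩
      rwa [add_sub_cancel, add_sub_cancel]
    · rintro ⟨i, j, ⟨h, hS⟩, rfl, rfl⟩
      exact ⟨by omega, hS⟩
  rw [hT, hinj.encard_image, Set.encard_coe_eq_coe_finsetCard, Nat.cast_inj] at h
  rw [← h, ← sum_product']
  simp only [cellIndicator, T, sum_boole]

lemma sum_cellIndicator_of_isGraphCovering {r a b : ℕ} {S : Set (ℤ × ℤ)}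
    (hS : IsGraphCovering kingGrid r b a S) (x y : ℤ) :
    ∑ j ∈ Icc (-(r : ℤ)) r, ∑ i ∈ Icc (-(r : ℤ)) r, cellIndicator S (x + i) (y + j) =
      a + ((b : ℤ) - a) * cellIndicator S x y := by
  by_cases h : (x, y) ∈ S
  · rw [encard_closedNeighborhood_inter r S x y ((hS (x, y)).1 h)]
    simp [cellIndicator, h]
  · rw [encard_closedNeighborhood_inter r S x y ((hS (x, y)).2 h)]
    simp [cellIndicator, h]

lemma isBoxEigen_sub_translate {r a b : ℕ} {S : Set (ℤ × ℤ)}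
    (hS : IsGraphCovering kingGrid r b a S) (s t : ℤ × ℤ) :
    IsBoxEigen r ((b : ℤ) - a) fun x y =>
      cellIndicator S (x + s.1) (y + s.2) - cellIndicator S (x + t.1) (y + t.2) where
  abs_le_one x y := by
    unfold cellIndicator
    split_ifs <;> simp
  sum_eq x y := by
    have h₁ := sum_cellIndicator_of_isGraphCovering hS (x + s.1) (y + s.2)
    have h₂ := sum_cellIndicator_of_isGraphCovering hS (x + t.1) (y + t.2)
    simp only [sum_sub_distrib, add_right_comm x _ _, add_right_comm y _ _] at *
    linarith

lemma exists_period {r a b : ℕ} (hr : 1 ≤ r) (hab : a ≠ b) {S : Set (ℤ × ℤ)}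
    (hS : IsGraphCovering kingGrid r b a S) (t : ℤ × ℤ) :
    ∃ n : ℕ, 0 < n ∧ ∀ u : ℤ × ℤ, u + n • t ∈ S ↔ u ∈ S := by
  classical
  -- A side length for which `IsBoxEigen.eq_zero_of_rect` applies.
  let L : ℕ := 5 * (2 * r + 1)
  let pattern : ℕ → Set (Fin (L + 1) × Fin (L + 1)) := fun n =>
    {p | (((p.1 : ℕ) : ℤ), ((p.2 : ℕ) : ℤ)) + n • t ∈ S}
  obtain ⟨m, n, hmn, hp⟩ : ∃ m n, m < n ∧ pattern m = pattern n := by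
    obtain ⟨m, n, hne, h⟩ := Finite.exists_ne_map_eq_of_infinite pattern
    rcases lt_or_gt_of_ne hne with hlt | hlt
    · exact ⟨m, n, hlt, h⟩
    · exact ⟨n, m, hlt, h.symm⟩
  have hzero := (isBoxEigen_sub_translate hS (m • t) (n • t)).eq_zero_of_rect hr
    (k := (b : ℤ) - a) (by omega) (x₀ := 0) (x₁ := L) (y₀ := 0) (y₁ := L)
    (by simp [L]) (by simp [L]) (by
      intro x y hx₀ hx₁ hy₀ hy₁
      lift x to ℕ using hx₀
      lift y to ℕ using hy₀
      have h := Set.ext_iff.mp hp (⟨x, by omega⟩, ⟨y, by omega⟩)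
      simp only [pattern, Set.mem_ofPred_eq] at h
      rw [sub_eq_zero]
      exact if_congr h rfl rfl)
  have hmem : ∀ u, u + m • t ∈ S ↔ u + n • t ∈ S := by
    intro u
    have h := sub_eq_zero.mp (hzero u.1 u.2)
    unfold cellIndicator at h
    change (if u + m • t ∈ S then (1 : ℤ) else 0) = if u + n • t ∈ S then (1 : ℤ) else 0 at h
    split_ifs at h <;> simp_all
  refine ⟨n - m, by omega, fun u => ?_⟩
  have h := hmem (u - m • t)
  rw [sub_add_cancel, sub_add_eq_add_sub, add_sub_assoc,
    show n • t - m • t = (n - m) • t by rw [sub_nsmul _ hmn.le, sub_eq_add_neg]] at h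
  exact h.symm

lemma linearIndependent_smul_axes {m n : ℕ} (hm : 0 < m) (hn : 0 < n) :
    LinearIndependent ℤ ![m • ((1, 0) : ℤ × ℤ), n • ((0, 1) : ℤ × ℤ)] := by
  rw [LinearIndependent.pair_iff]
  intro s t h
  simp only [Prod.smul_mk, Prod.mk_add_mk, Prod.mk_eq_zero, smul_eq_mul, nsmul_eq_mul] at h
  simpa [hm.ne', hn.ne'] using h

end PerfectCovering

theorem mainTheorem1 (r : ℕ) (hr : 1 ≤ r) (a b : ℕ) (hab : a ≠ b) :
    (∀ c : PerfectCovering.BinaryConfiguration,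
      PerfectCovering.IsShapeCovering
        (PerfectCovering.closedNeighborhood PerfectCovering.kingGrid r 0) b a c →
      PerfectCovering.IsTwoPeriodicConfiguration c) ∧
    (∀ S : Set (ℤ × ℤ),
      PerfectCovering.IsGraphCovering PerfectCovering.kingGrid r b a S →
      PerfectCovering.IsTwoPeriodicCode S) := by
  open PerfectCovering in
  constructor
  · intro c hc
    have hS : IsGraphCovering kingGrid r b a {u | c u = 1} := by
      intro u
      have h := hc u
      rw [image_add_closedNeighborhood_kingGrid] at h
      exact ⟨h.1, fun h₁ => h.2 (by simp only [Set.mem_ofPred_eq] at h₁; omega)⟩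
    have htranslate : ∀ t : ℤ × ℤ, (∀ u, u + t ∈ {u | c u = 1} ↔ u ∈ {u | c u = 1}) →
        PerfectCovering.translate t c = c := by
      intro t ht
      funext u
      have h := ht (u - t)
      simp only [sub_add_cancel, Set.mem_ofPred_eq] at h
      simp only [PerfectCovering.translate]
      omega
    obtain ⟨m, hm, hm'⟩ := exists_period hr hab hS (1, 0)
    obtain ⟨n, hn, hn'⟩ := exists_period hr hab hS (0, 1)
    exact ⟨_, _, linearIndependent_smul_axes hm hn, htranslate _ hm', htranslate _ hn'⟩
  · intro S hS
    have himage : ∀ t : ℤ × ℤ, (∀ u, u + t ∈ S ↔ u ∈ S) → S = (fun s => s + t) '' S := by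
      intro t ht
      ext u
      rw [Set.image_add_right, Set.mem_preimage, ← ht (u + -t), neg_add_cancel_right]
    obtain ⟨m, hm, hm'⟩ := exists_period hr hab hS (1, 0)
    obtain ⟨n, hn, hn'⟩ := exists_period hr hab hS (0, 1)
    exact ⟨_, _, linearIndependent_smul_axes hm hn, himage _ hm', himage _ hn'⟩
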